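/- Let $A\in GL_3(\mathbb Z)$ have real eigenvalues $\lambda_1<1<\lambda_2<\lambda_3$, and denote also by $A$ the induced automorphism of the torus $\mathbb T^3=\mathbb R^3/\mathbb Z^3$. Let $E_2\subset\mathbb R^3$ be the (one-dimensional) eigenspace of $\lambda_2$; the center leaf of $x\in\mathbb T^3$ is $\mathcal F^c(x)=\{x+\pi(v): v\in E_2\}$, where $\pi:\mathbb R^3\to\mathbb T^3$ is the projection. Let $\mu$ be an ergodic $A$-invariant Borel probability measure on $\mathbb T^3$ whose Kolmogorov–Sinai entropy satisfies $h_\mu(A)>\log\lambda_3$. Then for every set $Z\subset\mathbb T^3$ of full $\mu$-measure, the intersection $Z\cap\mathcal F^c(x)$ is uncountable for $\mu$-almost every $x\in\mathbb T^3$. -/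

import Mathlib

open MeasureTheory Filter

noncomputable section

namespace TorusEntropy

/-- The Shannon entropy of the refined partition `ξ ∨ f⁻¹ξ ∨ ⋯ ∨ f⁻⁽ⁿ⁻¹⁾ξ`, where the finite
partition is given by its labelling `ξ : X → Fin k`. The block with itinerary `w` is the set of
points `x` with `ξ (f^i x) = w i` for all `i < n`; empty blocks contribute `0`. -/
def blockEntropy {X : Type*} [MeasurableSpace X] (μ : Measure X) (f : X → X) {k : ℕ}
    (ξ : X → Fin k) (n : ℕ) : ℝ :=
  ∑ w : Fin n → Fin k, Real.negMulLog (μ.real {x | ∀ i : Fin n, ξ (f^[i] x) = w i})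

/-- The entropy `h_μ(f, ξ)` of `f` relative to a finite partition: the limit of
`(1/n) H_μ(ξ ∨ ⋯ ∨ f⁻⁽ⁿ⁻¹⁾ξ)`, written as a limsup (the limit exists when `μ` is
an `f`-invariant probability measure and `ξ` is measurable). -/
def partitionEntropy {X : Type*} [MeasurableSpace X] (μ : Measure X) (f : X → X) {k : ℕ}
    (ξ : X → Fin k) : EReal :=
  limsup (fun n : ℕ => ((blockEntropy μ f ξ n / n : ℝ) : EReal)) atTop

/-- The Kolmogorov–Sinai entropy `h_μ(f)`: the supremum of `h_μ(f, ξ)` over all finite measurable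
partitions `ξ`. -/
def metricEntropy {X : Type*} [MeasurableSpace X] (μ : Measure X) (f : X → X) : EReal :=
  ⨆ (k : ℕ) (ξ : X → Fin k) (_ : Measurable ξ), partitionEntropy μ f ξ

/-- The torus `𝕋³ = ℝ³/ℤ³`. -/
abbrev Torus3 : Type := Fin 3 → UnitAddCircle

/-- The projection `ℝ³ → 𝕋³`. -/
def proj (v : Fin 3 → ℝ) : Torus3 := fun i => (v i : UnitAddCircle)

/-- The map of `𝕋³` induced by an integer matrix. -/
def torusMap (A : Matrix (Fin 3) (Fin 3) ℤ) (x : Torus3) : Torus3 :=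
  fun i => ∑ j, A i j • x j

/-- The real linear map of `ℝ³` given by an integer matrix. -/
def realMap (A : Matrix (Fin 3) (Fin 3) ℤ) : Module.End ℝ (Fin 3 → ℝ) :=
  Matrix.toLin' (A.map (Int.cast : ℤ → ℝ))

/-- The leaf through `x` of the linear foliation of `𝕋³` tangent to the `lam`-eigenspace of `A`. -/
def eigenLeaf (A : Matrix (Fin 3) (Fin 3) ℤ) (lam : ℝ) (x : Torus3) : Set Torus3 :=
  {y | ∃ v ∈ Module.End.eigenspace (realMap A) lam, y = x + proj v}

/-- `torusMap A` is the quotient of the linear action of `A` on `ℝ³`. -/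
theorem torusMap_proj (A : Matrix (Fin 3) (Fin 3) ℤ) (v : Fin 3 → ℝ) :
    torusMap A (proj v) = proj (realMap A v) := by
  funext i
  simp [torusMap, proj, realMap, Matrix.mulVec, dotProduct, Fin.sum_univ_three,
    ← zsmul_eq_mul]

end TorusEntropy

end

open ProbabilityTheory

noncomputable section

namespace TorusEntropy

/-! Argue by contradiction. Number the eigen-coordinates 0, 1, 2, with 1 the center direction.
Suppose that `Z` meets the center leaves in countable sets on a non-null set of points. Disintegrate
`μ` along center plaques in the fundamental domain `[0,1)³`. A probability carried by a countable
set has an atom, and isolating atoms (`ae_not_countable_inter_fiber`) yields a non-null set that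
meets each plaque at most once. Inside it lies a compact non-null `K` meeting every short center
segment at most once (`exists_compact_transversal`). By compactness, two points of `K` that are
`r`-close in the center direction and very close in the other two are in fact `ε`-close in the
center direction (`exists_transversal_modulus`).

This forces entropy at most `log λ₃`. To follow orbits for time `n`, start with boxes of mesh `δ × ε
× δ/λ₃ⁿ`, up to a bounded excess of time. Their number has logarithm `n log λ₃ + O(1)`, and only the
center displacement can then grow too large. In each time window of length `M`, record the first
visit to `K`, or an `ε`-box if there is none. Common visits to `K` bring the bound on the center
displacement back to `ε`, and fewer than `2M` steps separate successive checks, so `ε = r/λ₂^(2M)`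
keeps it below `r` (`coord_bound_of_visit_labels`). Visit times cost about `(log M)/M` per unit
time. The `ε`-boxes cost `O(M)` per window but, by ergodicity, are needed with probability tending
to `0`. Hence every finite partition has entropy at most `log λ₃` (`exists_blockEntropy_le`). -/

/-! ### Shannon entropy of finite-valued maps -/

/-- Shannon entropy of the partition into the level sets of a finite-valued map. -/
def labelEntropy {Ω α : Type*} [MeasurableSpace Ω] [Fintype α] (μ : Measure Ω) (X : Ω → α) : ℝ :=
  ∑ a, Real.negMulLog (μ.real (X ⁻¹' {a}))

theorem blockEntropy_eq_labelEntropy {Ω : Type*} [MeasurableSpace Ω] (μ : Measure Ω) (f : Ω → Ω)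
    {k : ℕ} (ξ : Ω → Fin k) (n : ℕ) :
    blockEntropy μ f ξ n = labelEntropy μ (fun x (i : Fin n) => ξ (f^[i] x)) := by
  unfold blockEntropy labelEntropy
  congr! 4 with w
  ext x
  simp [funext_iff]

/-- The Gibbs inequality. -/
theorem sum_negMulLog_le {α : Type*} [Fintype α] (p q : α → ℝ) (hp : ∀ a, 0 ≤ p a)
    (hq : ∀ a, 0 ≤ q a) (hpq : ∑ a, q a ≤ ∑ a, p a) (h0 : ∀ a, q a = 0 → p a = 0) :
    ∑ a, Real.negMulLog (p a) ≤ ∑ a, -(p a * Real.log (q a)) := by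
  have key : ∀ a, Real.negMulLog (p a) ≤ -(p a * Real.log (q a)) + (q a - p a) := by
    intro a
    rcases (hp a).eq_or_lt with h | h
    · simp [← h, hq a]
    · have hqa : 0 < q a := (hq a).lt_of_ne fun h' => h.ne' (h0 a h'.symm)
      -- The inequality `log t ≤ t - 1` at `t = q a / p a`. The resulting error terms `q a - p a`
      -- have nonpositive sum.
      have h1 := Real.log_le_sub_one_of_pos (div_pos hqa h)
      rw [Real.log_div hqa.ne' h.ne'] at h1
      have h2 := mul_le_mul_of_nonneg_left h1 h.le
      have h3 : p a * (q a / p a - 1) = q a - p a := by field_simp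
      rw [Real.negMulLog]
      linarith
  calc ∑ a, Real.negMulLog (p a) ≤ ∑ a, (-(p a * Real.log (q a)) + (q a - p a)) :=
        Finset.sum_le_sum fun a _ => key a
    _ ≤ _ := by rw [Finset.sum_add_distrib, Finset.sum_sub_distrib]; linarith

theorem labelEntropy_comp_measurePreserving {Ω α : Type*} [MeasurableSpace Ω] {μ : Measure Ω}
    [Fintype α] [MeasurableSpace α] [MeasurableSingletonClass α] {X : Ω → α} (hX : Measurable X)
    {f : Ω → Ω} (hf : MeasurePreserving f μ μ) :
    labelEntropy μ (fun x => X (f x)) = labelEntropy μ X := by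
  unfold labelEntropy
  refine Finset.sum_congr rfl fun a _ => ?_
  congr 1
  exact hf.measureReal_preimage (hX (measurableSet_singleton a)).nullMeasurableSet

instance {α β : Type*} [MeasurableSpace α] [MeasurableSpace β] [MeasurableSingletonClass α]
    [MeasurableSingletonClass β] : MeasurableSingletonClass (α ⊕ β) where
  measurableSet_singleton := by
    rintro (a | b)
    · simpa using (measurableSet_singleton a).inl_image (β := β)
    · simpa using (measurableSet_singleton b).inr_image (α := α)

section
variable {Ω : Type*} [MeasurableSpace Ω] {μ : Measure Ω} [IsProbabilityMeasure μ]
  {α β : Type*} [Fintype α] [Fintype β] [MeasurableSpace α] [MeasurableSpace β]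
  [MeasurableSingletonClass α] [MeasurableSingletonClass β]

theorem sum_measureReal_preimage_inter {X : Ω → α} (hX : Measurable X) (s : Set Ω) :
    ∑ a, μ.real (X ⁻¹' {a} ∩ s) = μ.real s := by
  have hd : Pairwise (Function.onFun Disjoint fun a => X ⁻¹' {a}) := by
    intro a b hab
    exact Disjoint.preimage X (by simpa using hab)
  have h := measureReal_iUnion_fintype (μ := μ.restrict s) hd
    (fun a => hX (measurableSet_singleton a))
  have hU : ⋃ a, X ⁻¹' {a} = Set.univ := by ext x; simp
  rw [hU] at h
  simp only [measureReal_def, Measure.restrict_apply_univ,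
    Measure.restrict_apply (hX (measurableSet_singleton _))] at h ⊢
  exact h.symm

theorem sum_measureReal_preimage {X : Ω → α} (hX : Measurable X) :
    ∑ a, μ.real (X ⁻¹' {a}) = 1 := by
  simpa using sum_measureReal_preimage_inter (μ := μ) hX Set.univ

/-- Gibbs inequality against the uniform distribution. -/
theorem labelEntropy_le_log_card {X : Ω → α} (hX : Measurable X) :
    labelEntropy μ X ≤ Real.log (Fintype.card α) := by
  have h1 := sum_measureReal_preimage (μ := μ) hX
  have hne : Nonempty α := by
    by_contra h
    rw [not_nonempty_iff] at h
    simp at h1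
  have hc : (0 : ℝ) < Fintype.card α := by exact_mod_cast Fintype.card_pos
  refine (sum_negMulLog_le _ (fun _ => (Fintype.card α : ℝ)⁻¹) (fun _ => measureReal_nonneg)
    (fun _ => by positivity) ?_ ?_).trans ?_
  · rw [h1]; simp [hc.ne']
  · intro a h; exact absurd h (by positivity)
  · simp only [Real.log_inv, mul_neg, neg_neg]
    rw [← Finset.sum_mul, h1, one_mul]

/-- Merging atoms increases the mass inside each logarithm, so each term of the sum can only drop.
-/
theorem labelEntropy_comp_le {γ : Type*} [Fintype γ] {X : Ω → α} (hX : Measurable X) (g : α → γ) :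
    labelEntropy μ (g ∘ X) ≤ labelEntropy μ X := by
  classical
  have hP : ∀ b, μ.real ((g ∘ X) ⁻¹' {b}) = ∑ a with g a = b, μ.real (X ⁻¹' {a}) := by
    intro b
    rw [← sum_measureReal_preimage_inter (μ := μ) hX, Finset.sum_filter]
    refine Finset.sum_congr rfl fun a _ => ?_
    split_ifs with h
    · congr 1; ext x; simp only [Set.mem_inter_iff, Set.mem_preimage, Set.mem_singleton_iff,
        Function.comp]; grind
    · have : X ⁻¹' {a} ∩ g ∘ X ⁻¹' {b} = ∅ := by
        ext x; simp only [Set.mem_inter_iff, Set.mem_preimage, Set.mem_singleton_iff,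
          Function.comp, Set.mem_empty_iff_false]; grind
      simp [this]
  unfold labelEntropy
  rw [← Finset.sum_fiberwise (s := Finset.univ) (g := g)]
  refine Finset.sum_le_sum fun b _ => ?_
  rw [hP, Real.negMulLog, neg_mul, Finset.sum_mul, ← Finset.sum_neg_distrib]
  refine Finset.sum_le_sum fun a ha => ?_
  rw [Real.negMulLog, neg_mul, neg_le_neg_iff]
  rcases (measureReal_nonneg (μ := μ) (s := X ⁻¹' {a})).eq_or_lt with h | h
  · simp [← h]
  · refine mul_le_mul_of_nonneg_left (Real.log_le_log h ?_) h.le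
    exact Finset.single_le_sum (f := fun a => μ.real (X ⁻¹' {a}))
      (fun _ _ => measureReal_nonneg) ha

theorem labelEntropy_le_of_factors {γ : Type*} [Fintype γ] {X : Ω → α} (hX : Measurable X)
    {Y : Ω → γ}
    (h : ∀ x y, X x = X y → Y x = Y y) : labelEntropy μ Y ≤ labelEntropy μ X := by
  obtain ⟨x₀⟩ : Nonempty Ω := μ.nonempty_of_neZero
  have : Nonempty γ := ⟨Y x₀⟩
  obtain ⟨g, rfl⟩ := (Function.factorsThrough_iff Y).1 (show Function.FactorsThrough Y X from
    fun x y hxy => h x y hxy)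
  exact labelEntropy_comp_le hX g

/-- Gibbs inequality for the joint law against the product of its marginals. -/
theorem labelEntropy_prod_le {X : Ω → α} (hX : Measurable X) {Y : Ω → β} (hY : Measurable Y) :
    labelEntropy μ (fun x => (X x, Y x)) ≤ labelEntropy μ X + labelEntropy μ Y := by
  have hset : ∀ a b, (fun x => (X x, Y x)) ⁻¹' {(a, b)} = X ⁻¹' {a} ∩ Y ⁻¹' {b} := by
    intro a b; ext x; simp
  have h1 := sum_measureReal_preimage (μ := μ) hX
  have h2 := sum_measureReal_preimage (μ := μ) hY
  have hXY := sum_measureReal_preimage (μ := μ) (hX.prodMk hY)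
  refine (sum_negMulLog_le _ (fun c : α × β => μ.real (X ⁻¹' {c.1}) * μ.real (Y ⁻¹' {c.2}))
    (fun _ => measureReal_nonneg) (fun _ => by positivity) ?_ ?_).trans ?_
  · rw [hXY, Fintype.sum_prod_type]
    simp only [← Finset.mul_sum, h2, mul_one, h1, le_refl]
  · rintro ⟨a, b⟩ h
    rw [hset]
    refine le_antisymm ?_ measureReal_nonneg
    rcases mul_eq_zero.1 h with h | h <;> rw [← h]
    · exact measureReal_mono Set.inter_subset_left
    · exact measureReal_mono Set.inter_subset_right
  · have hsplit : ∀ c : α × β, -(μ.real ((fun x => (X x, Y x)) ⁻¹' {c}) *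
        Real.log (μ.real (X ⁻¹' {c.1}) * μ.real (Y ⁻¹' {c.2}))) =
        μ.real (X ⁻¹' {c.1} ∩ Y ⁻¹' {c.2}) * -Real.log (μ.real (X ⁻¹' {c.1})) +
        μ.real (Y ⁻¹' {c.2} ∩ X ⁻¹' {c.1}) * -Real.log (μ.real (Y ⁻¹' {c.2})) := by
      rintro ⟨a, b⟩
      rw [hset, Set.inter_comm (Y ⁻¹' {b})]
      by_cases ha : μ.real (X ⁻¹' {a}) = 0
      · have : μ.real (X ⁻¹' {a} ∩ Y ⁻¹' {b}) = 0 :=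
          le_antisymm (ha ▸ measureReal_mono Set.inter_subset_left) measureReal_nonneg
        simp [this]
      by_cases hb : μ.real (Y ⁻¹' {b}) = 0
      · have : μ.real (X ⁻¹' {a} ∩ Y ⁻¹' {b}) = 0 :=
          le_antisymm (hb ▸ measureReal_mono Set.inter_subset_right) measureReal_nonneg
        simp [this]
      rw [Real.log_mul ha hb]; ring
    rw [Finset.sum_congr rfl fun c _ => hsplit c, Finset.sum_add_distrib]
    refine add_le_add (le_of_eq ?_) (le_of_eq ?_)
    · rw [Fintype.sum_prod_type]
      refine Finset.sum_congr rfl fun a _ => ?_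
      simp only
      rw [← Finset.sum_mul]
      simp only [Set.inter_comm (X ⁻¹' {a})]
      rw [sum_measureReal_preimage_inter hY, Real.negMulLog]; ring
    · rw [Fintype.sum_prod_type_right]
      refine Finset.sum_congr rfl fun b _ => ?_
      simp only
      rw [← Finset.sum_mul]
      simp only [Set.inter_comm (Y ⁻¹' {b})]
      rw [sum_measureReal_preimage_inter hX, Real.negMulLog]; ring

theorem labelEntropy_block_le {X : Ω → α} (hX : Measurable X) {f : Ω → Ω}
    (hf : MeasurePreserving f μ μ) (n : ℕ) :
    labelEntropy μ (fun x (i : Fin n) => X (f^[i] x)) ≤ n * labelEntropy μ X := by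
  classical
  have hmeas : ∀ n : ℕ, Measurable fun x (i : Fin n) => X (f^[i] x) := fun n =>
    measurable_pi_lambda _ fun i => hX.comp (hf.measurable.iterate i)
  induction n with
  | zero =>
    refine (labelEntropy_le_log_card (hmeas 0)).trans ?_
    simp
  | succ n ih =>
    have h1 : labelEntropy μ (fun x (i : Fin (n + 1)) => X (f^[i] x)) ≤
        labelEntropy μ (fun x => (X x, fun i : Fin n => X (f^[i] (f x)))) := by
      refine labelEntropy_le_of_factors (hX.prodMk ((hmeas n).comp hf.measurable)) ?_
      intro x y hxy
      simp only [Prod.mk.injEq, funext_iff] at hxy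
      funext i
      refine Fin.cases ?_ (fun i => ?_) i
      · simpa using hxy.1
      · simpa [Function.iterate_succ_apply] using hxy.2 i
    have h2 := labelEntropy_prod_le (μ := μ) hX ((hmeas n).comp hf.measurable)
    have h3 := labelEntropy_comp_measurePreserving (hmeas n) hf
    simp only [Function.comp_def] at h2
    push_cast
    linarith

/-- Entropy bound for a map taking values in two groups of labels. -/
theorem labelEntropy_sum_le {X : Ω → α ⊕ β} (hX : Measurable X) [Nonempty α] [Nonempty β] :
    labelEntropy μ X ≤ Real.binEntropy (μ.real (X ⁻¹' Set.range Sum.inr)) +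
      Real.log (Fintype.card α) +
      μ.real (X ⁻¹' Set.range Sum.inr) * Real.log (Fintype.card β) := by
  set ρ := μ.real (X ⁻¹' Set.range Sum.inr) with hρ
  have hsum := sum_measureReal_preimage (μ := μ) hX
  rw [Fintype.sum_sum_type] at hsum
  have hr : ∑ b, μ.real (X ⁻¹' {Sum.inr b}) = ρ := by
    have := measureReal_iUnion_fintype (μ := μ) (f := fun b : β => X ⁻¹' {Sum.inr b})
      (fun a b hab => Disjoint.preimage X (by simpa using hab))
      (fun b => hX (measurableSet_singleton _))
    rw [← this, hρ]
    congr 1; ext x; simp [eq_comm]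
  have hl : ∑ a, μ.real (X ⁻¹' {Sum.inl a}) = 1 - ρ := by linarith
  have hρ0 : 0 ≤ ρ := measureReal_nonneg
  have hρ1 : ρ ≤ 1 := measureReal_le_one
  have ca : (0 : ℝ) < Fintype.card α := by exact_mod_cast Fintype.card_pos
  have cb : (0 : ℝ) < Fintype.card β := by exact_mod_cast Fintype.card_pos
  have ca1 : (1 : ℝ) ≤ Fintype.card α := by exact_mod_cast Fintype.card_pos
  have hmon : ∀ c, μ.real (X ⁻¹' {c}) ≤ Sum.elim (fun _ => 1 - ρ) (fun _ => ρ) c := by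
    rintro (a | b)
    · rw [Sum.elim_inl, ← hl]
      exact Finset.single_le_sum (f := fun a => μ.real (X ⁻¹' {Sum.inl a}))
        (fun _ _ => measureReal_nonneg) (Finset.mem_univ a)
    · rw [Sum.elim_inr, ← hr]
      exact Finset.single_le_sum (f := fun a => μ.real (X ⁻¹' {Sum.inr a}))
        (fun _ _ => measureReal_nonneg) (Finset.mem_univ b)
  -- Compare with the law giving the two groups their true masses `1 - ρ` and `ρ`, spread uniformly
  -- within each group.
  refine (sum_negMulLog_le _ (Sum.elim (fun _ => (1 - ρ) / Fintype.card α)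
    (fun _ => ρ / Fintype.card β)) (fun _ => measureReal_nonneg) ?_ ?_ ?_).trans ?_
  · rintro (a | b)
    · exact div_nonneg (by linarith) ca.le
    · exact div_nonneg hρ0 cb.le
  · rw [Fintype.sum_sum_type, Fintype.sum_sum_type, hr, hl]
    simp only [Sum.elim_inl, Sum.elim_inr, Finset.sum_const, Finset.card_univ, nsmul_eq_mul]
    rw [mul_div_cancel₀ _ ca.ne', mul_div_cancel₀ _ cb.ne']
  · rintro (a | b) h
    · have h' : 1 - ρ = 0 := by simpa [ca.ne'] using h
      exact le_antisymm ((hmon (.inl a)).trans h'.le) measureReal_nonneg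
    · have h' : ρ = 0 := by simpa [cb.ne'] using h
      exact le_antisymm ((hmon (.inr b)).trans h'.le) measureReal_nonneg
  · rw [Fintype.sum_sum_type]
    simp only [Sum.elim_inl, Sum.elim_inr, Finset.sum_neg_distrib, ← Finset.sum_mul, hl, hr]
    rw [Real.binEntropy_eq_negMulLog_add_negMulLog_one_sub, Real.negMulLog, Real.negMulLog]
    have e1 : (1 - ρ) * Real.log ((1 - ρ) / Fintype.card α) =
        (1 - ρ) * Real.log (1 - ρ) - (1 - ρ) * Real.log (Fintype.card α) := by
      rcases eq_or_ne (1 - ρ) 0 with h | h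
      · simp [h]
      · rw [Real.log_div h ca.ne']; ring
    have e2 : ρ * Real.log (ρ / Fintype.card β) =
        ρ * Real.log ρ - ρ * Real.log (Fintype.card β) := by
      rcases eq_or_ne ρ 0 with h | h
      · simp [h]
      · rw [Real.log_div h cb.ne']; ring
    rw [e1, e2]
    have := mul_nonneg hρ0 (Real.log_nonneg ca1)
    linarith

end

/-! ### The torus and its linear structure -/

theorem proj_sub (v w : Fin 3 → ℝ) : proj (v - w) = proj v - proj w := by
  funext i; simp [proj]

theorem continuous_proj : Continuous proj :=
  continuous_pi fun i => continuous_quotient_mk'.comp (continuous_apply i)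

theorem eq_of_proj_eq {v w : Fin 3 → ℝ} (h : proj v = proj w) (hlt : ∀ i, |v i - w i| < 1) :
    v = w := by
  funext i
  have h1 : ((v i - w i : ℝ) : UnitAddCircle) = 0 := by
    have := congrFun h i
    simpa [proj, sub_eq_zero] using this
  obtain ⟨n, hn⟩ := AddCircle.coe_eq_zero_iff (p := (1 : ℝ)) |>.1 h1
  have h2 : (n : ℝ) = v i - w i := by simpa using hn
  have h3 := hlt i
  rw [← h2] at h3
  have h4 : n = 0 := Int.abs_lt_one_iff.1 (by exact_mod_cast h3)
  rw [h4] at h2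
  simp at h2
  linarith

theorem dist_add_proj_le (x : Torus3) (v : Fin 3 → ℝ) : dist x (x + proj v) ≤ ‖v‖ := by
  refine (dist_pi_le_iff (norm_nonneg v)).2 fun i => ?_
  have h1 : dist (x i) ((x + proj v) i) = ‖((v i : ℝ) : UnitAddCircle)‖ := by
    rw [dist_eq_norm, ← norm_neg]; congr 1; simp [proj]
  have h2 : ‖((v i : ℝ) : UnitAddCircle)‖ ≤ ‖v i‖ := QuotientAddGroup.norm_mk_le_norm
  rw [h1]
  exact h2.trans (norm_le_pi_norm v i)

theorem torusMap_add (A : Matrix (Fin 3) (Fin 3) ℤ) (x y : Torus3) :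
    torusMap A (x + y) = torusMap A x + torusMap A y := by
  funext i
  simp [torusMap, Finset.sum_add_distrib]

theorem torusMap_iterate_add_proj (A : Matrix (Fin 3) (Fin 3) ℤ) (j : ℕ) (x : Torus3)
    (v : Fin 3 → ℝ) :
    (torusMap A)^[j] (x + proj v) = (torusMap A)^[j] x + proj ((realMap A ^ j) v) := by
  induction j with
  | zero => simp
  | succ j ih =>
    rw [Function.iterate_succ_apply', ih, torusMap_add, torusMap_proj,
      Function.iterate_succ_apply', pow_succ']
    rfl

/-- The representative of a point of the torus in `[0,1)³`. -/
def lift (x : Torus3) : Fin 3 → ℝ := fun i => (AddCircle.equivIco 1 0 (x i) : ℝ)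

theorem proj_lift (x : Torus3) : proj (lift x) = x := by
  funext i
  exact AddCircle.coe_equivIco

theorem lift_mem (x : Torus3) (i : Fin 3) : lift x i ∈ Set.Ico (0 : ℝ) 1 := by
  have := (AddCircle.equivIco (1 : ℝ) 0 (x i)).2
  simpa [lift] using this

theorem measurable_lift : Measurable lift :=
  measurable_pi_lambda _ fun i => measurable_subtype_coe.comp
    ((AddCircle.measurableEquivIco (1 : ℝ) 0).measurable.comp (measurable_pi_apply i))

theorem eq_add_proj_lift_sub (x y : Torus3) : y = x + proj (lift y - lift x) := by
  rw [proj_sub, proj_lift, proj_lift]; abel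

/-! ### The eigenbasis -/

theorem exists_eigenbasis {A : Matrix (Fin 3) (Fin 3) ℤ} {lam : Fin 3 → ℝ}
    (hlam : Function.Injective lam) (h : ∀ i, (realMap A).HasEigenvalue (lam i)) :
    ∃ b : Module.Basis (Fin 3) ℝ (Fin 3 → ℝ), ∀ i, realMap A (b i) = lam i • b i := by
  choose v hv using fun i => (h i).exists_hasEigenvector
  have hli := Module.End.eigenvectors_linearIndependent' (realMap A) lam hlam v hv
  refine ⟨basisOfLinearIndependentOfCardEqFinrank hli (by simp), fun i => ?_⟩
  simpa using (hv i).apply_eq_smul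

/-- The determinant is a unit of `ℤ`. This is what later bounds `|λ₁|` from a bare upper bound on
`λ₁`. -/
theorem abs_prod_eigenvalues {A : Matrix (Fin 3) (Fin 3) ℤ} (hA : IsUnit A.det) {lam : Fin 3 → ℝ}
    {b : Module.Basis (Fin 3) ℝ (Fin 3 → ℝ)} (hb : ∀ i, realMap A (b i) = lam i • b i) :
    |∏ i, lam i| = 1 := by
  have h1 : LinearMap.det (realMap A) = ∏ i, lam i := by
    rw [← LinearMap.det_toMatrix b]
    have : LinearMap.toMatrix b b (realMap A) = Matrix.diagonal lam := by
      ext i j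
      rw [LinearMap.toMatrix_apply, hb]
      simp only [map_smul, Module.Basis.repr_self, Finsupp.smul_apply, Finsupp.single_apply,
        Matrix.diagonal_apply, smul_eq_mul, mul_ite, mul_one, mul_zero]
      split_ifs <;> simp_all
    rw [this, Matrix.det_diagonal]
  have h2 : LinearMap.det (realMap A) = (A.det : ℝ) := by
    rw [realMap, LinearMap.det_toLin']
    exact (RingHom.map_det (Int.castRingHom ℝ) A).symm
  rw [← h1, h2]
  rcases Int.isUnit_iff.1 hA with h | h <;> simp [h]

section
variable (b : Module.Basis (Fin 3) ℝ (Fin 3 → ℝ))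

theorem coord_realMap_pow {A : Matrix (Fin 3) (Fin 3) ℤ} {lam : Fin 3 → ℝ}
    {b : Module.Basis (Fin 3) ℝ (Fin 3 → ℝ)} (hb : ∀ i, realMap A (b i) = lam i • b i)
    (j : ℕ) (v : Fin 3 → ℝ) (i : Fin 3) :
    b.coord i ((realMap A ^ j) v) = lam i ^ j * b.coord i v := by
  have h : ∀ v, b.coord i (realMap A v) = lam i * b.coord i v := by
    intro v
    have : b.coord i ∘ₗ realMap A = lam i • b.coord i := by
      refine b.ext fun k => ?_
      simp only [LinearMap.comp_apply, hb, map_smul, LinearMap.smul_apply, Module.Basis.coord_apply,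
        Module.Basis.repr_self, smul_eq_mul, Finsupp.single_apply]
      split_ifs with hk <;> simp [hk]
    exact LinearMap.congr_fun this v
  induction j with
  | zero => simp
  | succ j ih =>
    rw [pow_succ', Module.End.mul_apply, h, ih, pow_succ']; ring

theorem continuous_coord (i : Fin 3) : Continuous (b.coord i) :=
  LinearMap.continuous_of_finiteDimensional _

theorem norm_le_of_coord_le {v : Fin 3 → ℝ} {a : ℝ} (h : ∀ i, |b.coord i v| ≤ a) :
    ‖v‖ ≤ (∑ i, ‖b i‖) * a := by
  conv_lhs => rw [← b.sum_repr v]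
  rw [Finset.sum_mul]
  refine (norm_sum_le _ _).trans (Finset.sum_le_sum fun i _ => ?_)
  rw [norm_smul, mul_comm]
  exact mul_le_mul_of_nonneg_left (h i) (norm_nonneg _)

/-- Vectors with small coordinates are determined by their projection to the torus. -/
theorem eq_of_proj_eq_of_coord_le {r : ℝ} (hr : (∑ i, ‖b i‖) * (2 * r) < 1) {v w : Fin 3 → ℝ}
    (hv : ∀ i, |b.coord i v| ≤ r) (hw : ∀ i, |b.coord i w| ≤ r) (h : proj v = proj w) : v = w := by
  refine eq_of_proj_eq h fun i => lt_of_le_of_lt ?_ hr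
  have h1 : ‖v - w‖ ≤ (∑ i, ‖b i‖) * (2 * r) := norm_le_of_coord_le b fun i => by
    rw [map_sub]
    have := abs_sub (b.coord i v) (b.coord i w)
    linarith [hv i, hw i]
  exact (norm_le_pi_norm (v - w) i).trans h1

theorem exists_coord_lift_bound : ∃ B : ℝ, 0 < B ∧ ∀ x i, |b.coord i (lift x)| ≤ B := by
  refine ⟨∑ i, ‖(b.coord i).toContinuousLinearMap‖ + 1, by positivity, fun x i => ?_⟩
  have h1 := (b.coord i).toContinuousLinearMap.le_opNorm (lift x)
  have h2 : ‖lift x‖ ≤ 1 := (pi_norm_le_iff_of_nonneg zero_le_one).2 fun j => by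
    have := lift_mem x j
    rw [Real.norm_eq_abs, abs_le]
    constructor <;> linarith [this.1, this.2]
  have h3 := Finset.single_le_sum (f := fun i => ‖(b.coord i).toContinuousLinearMap‖)
    (fun _ _ => norm_nonneg _) (Finset.mem_univ i)
  have h4 := mul_le_mul_of_nonneg_left h2 (norm_nonneg (b.coord i).toContinuousLinearMap)
  simp only [LinearMap.coe_toContinuousLinearMap', Real.norm_eq_abs] at h1
  linarith

/-- Partitions of the torus into boxes of prescribed mesh in the coordinates of a basis. -/
theorem exists_box_label : ∃ B : ℝ, 0 < B ∧ ∀ a : Fin 3 → ℝ, (∀ i, 0 < a i) →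
    ∃ (m : ℕ) (ζ : Torus3 → Fin m), Measurable ζ ∧
      Real.log m ≤ ∑ i, Real.log (B / a i + 1) ∧
      ∀ x y, ζ x = ζ y → ∃ v, y = x + proj v ∧ ∀ i, |b.coord i v| ≤ a i := by
  obtain ⟨B, hB, hbd⟩ := exists_coord_lift_bound b
  -- Coordinates of lifts range over `[-B, B]`, of length `2 * B`. Cells are cut out by rounding
  -- down, whence the `+ 1` in the count.
  refine ⟨2 * B, by positivity, fun a ha => ?_⟩
  let m : Fin 3 → ℕ := fun i => ⌊2 * B / a i⌋₊ + 1
  have hlt : ∀ x i, ⌊(b.coord i (lift x) + B) / a i⌋₊ < m i := by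
    intro x i
    refine Nat.lt_succ_of_le (Nat.floor_le_floor ?_)
    have := ha i
    have := (abs_le.1 (hbd x i)).2
    gcongr
    linarith
  let ζ : Torus3 → ∀ i, Fin (m i) := fun x i => ⟨⌊(b.coord i (lift x) + B) / a i⌋₊, hlt x i⟩
  have hζ : Measurable ζ := by
    refine measurable_pi_lambda _ fun i => ?_
    refine measurable_to_countable' fun k => ?_
    have h1 : Measurable fun x => ⌊(b.coord i (lift x) + B) / a i⌋₊ :=
      Nat.measurable_floor.comp
        ((((continuous_coord b i).measurable.comp measurable_lift).add_const B).div_const _)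
    have h2 : (fun x => ζ x i) ⁻¹' {k} =
        (fun x => ⌊(b.coord i (lift x) + B) / a i⌋₊) ⁻¹' {(k : ℕ)} := by
      ext x
      simp [ζ, Fin.ext_iff]
    rw [h2]
    exact h1 (measurableSet_singleton _)
  refine ⟨Fintype.card (∀ i, Fin (m i)), Fintype.equivFin _ ∘ ζ,
    (Measurable.of_discrete).comp hζ, ?_, fun x y hxy => ?_⟩
  · rw [Fintype.card_pi, Nat.cast_prod, Real.log_prod (fun i _ => by
      simp only [Fintype.card_fin, m]; positivity)]
    refine Finset.sum_le_sum fun i _ => Real.log_le_log (by simp [m]; positivity) ?_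
    have h := Nat.floor_le (a := 2 * B / a i) (div_nonneg (by positivity) (ha i).le)
    simp only [Fintype.card_fin, m]
    push_cast
    linarith
  · refine ⟨lift y - lift x, eq_add_proj_lift_sub x y, fun i => ?_⟩
    have h1 := congrArg Fin.val (congrFun ((Fintype.equivFin _).injective hxy) i)
    simp only [ζ] at h1
    have hpos : ∀ x, 0 ≤ (b.coord i (lift x) + B) / a i := fun x =>
      div_nonneg (by linarith [(abs_le.1 (hbd x i)).1]) (ha i).le
    have hx1 := Nat.floor_le (hpos x)
    have hx2 := Nat.lt_floor_add_one ((b.coord i (lift x) + B) / a i)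
    have hy1 := Nat.floor_le (hpos y)
    have hy2 := Nat.lt_floor_add_one ((b.coord i (lift y) + B) / a i)
    rw [← h1] at hy1 hy2
    have h2 : |(b.coord i (lift y) + B) / a i - (b.coord i (lift x) + B) / a i| ≤ 1 := by
      rw [abs_le]; constructor <;> linarith
    rw [← sub_div, abs_div, abs_of_pos (ha i), div_le_one (ha i)] at h2
    rw [map_sub]
    rwa [add_sub_add_right_eq_sub] at h2

end

/-! ### Conditional measures along the fibres of a measurable map -/

/-- If every measurable set on which `q` is injective is null, then a set of full measure meets
almost every fibre of `q` in an uncountable set. -/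
theorem ae_not_countable_inter_fiber {X α : Type*} [MeasurableSpace X] [StandardBorelSpace X]
    [MeasurableSpace α] [MeasurableSpace.CountablySeparated (α × ℝ)] {μ : Measure X}
    [IsFiniteMeasure μ] {q : X → α} {h : X → ℝ} (hq : Measurable q) (hh : Measurable h)
    (hinj : ∀ x y, q x = q y → h x = h y → x = y)
    (hnull : ∀ S, MeasurableSet S → Set.InjOn q S → μ S = 0)
    {Z : Set X} (hZ : ∀ᵐ x ∂μ, x ∈ Z) :
    ∀ᵐ x ∂μ, ¬ (Z ∩ q ⁻¹' {q x}).Countable := by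
  obtain ⟨Z', hZ'Z, hZ'm, hZ'⟩ : ∃ Z' ⊆ Z, MeasurableSet Z' ∧ ∀ᵐ x ∂μ, x ∈ Z' := by
    refine ⟨(toMeasurable μ Zᶜ)ᶜ, Set.compl_subset_comm.1 (subset_toMeasurable μ _),
      (measurableSet_toMeasurable μ _).compl, ?_⟩
    rw [ae_iff]
    simp only [Set.mem_compl_iff, not_not]
    exact (measure_toMeasurable _).trans (ae_iff.1 hZ)
  set g : X → α × ℝ := fun x => (q x, h x) with hg
  have hgm : Measurable g := hq.prodMk hh
  have hgi : Function.Injective g := fun x y hxy =>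
    hinj x y (congrArg Prod.fst hxy) (congrArg Prod.snd hxy)
  set m := μ.map g with hm
  set κ := m.condKernel
  have hdis : m.fst ⊗ₘ κ = m := m.disintegrate κ
  -- Lusin–Souslin: injective measurable images of Borel sets are measurable.
  have hW : MeasurableSet (g '' Z') := hZ'm.image_of_measurable_injOn hgm hgi.injOn
  have hWae : ∀ᵐ p ∂m.fst, ∀ᵐ t ∂κ p, (p, t) ∈ g '' Z' := by
    refine Measure.ae_ae_of_ae_compProd (p := fun c => c ∈ g '' Z') ?_
    rw [hdis]
    refine (ae_map_iff (p := fun c => c ∈ g '' Z') hgm.aemeasurable hW).2 ?_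
    filter_upwards [hZ'] with x hx using Set.mem_image_of_mem g hx
  -- Atoms carrying more than half the conditional mass of a rational interval. A fibre has at most
  -- one for each interval, so `q` is injective on the preimage of `S c`, which is therefore null.
  let S : ℚ × ℚ → Set (α × ℝ) := fun c => {p | p.2 ∈ Set.Ioo (c.1 : ℝ) c.2 ∧
    κ p.1 (Set.Ioo (c.1 : ℝ) c.2) < 2 * κ p.1 {p.2}}
  have hSm : ∀ c, MeasurableSet (S c) := by
    intro c
    have hint : S c = Prod.snd ⁻¹' Set.Ioo (c.1 : ℝ) c.2 ∩
        {p | κ p.1 (Set.Ioo (c.1 : ℝ) c.2) < 2 * κ p.1 {p.2}} := rfl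
    rw [hint]
    refine (measurable_snd measurableSet_Ioo).inter (measurableSet_lt ?_ ?_)
    · exact (ProbabilityTheory.Kernel.measurable_coe κ measurableSet_Ioo).comp measurable_fst
    · refine Measurable.const_mul ?_ 2
      have := ProbabilityTheory.Kernel.measurable_kernel_prodMk_left
        (κ := κ.comap (Prod.fst : α × ℝ → α) measurable_fst)
        (t := {p : (α × ℝ) × ℝ | p.2 = p.1.2})
        (measurableSet_eq_fun measurable_snd measurable_fst.snd)
      exact this
  have hSnull : ∀ c, ∀ᵐ p ∂m.fst, ∀ᵐ t ∂κ p, (p, t) ∉ S c := by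
    intro c
    refine Measure.ae_ae_of_ae_compProd (p := fun p => p ∉ S c) ?_
    rw [hdis]
    refine (ae_map_iff (p := fun p => p ∉ S c) hgm.aemeasurable (hSm c).compl).2 ?_
    rw [ae_iff]
    simp only [not_not]
    refine hnull _ (hgm (hSm c)) ?_
    intro x hx y hy hxy
    refine hinj x y hxy ?_
    by_contra hne
    have hx' : h x ∈ Set.Ioo (c.1 : ℝ) c.2 ∧
      κ (q x) (Set.Ioo (c.1 : ℝ) c.2) < 2 * κ (q x) {h x} := hx
    have hy' : h y ∈ Set.Ioo (c.1 : ℝ) c.2 ∧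
      κ (q y) (Set.Ioo (c.1 : ℝ) c.2) < 2 * κ (q y) {h y} := hy
    rw [← hxy] at hy'
    have h1 : κ (q x) {h x} + κ (q x) {h y} ≤ κ (q x) (Set.Ioo (c.1 : ℝ) c.2) := by
      rw [← measure_union (by simpa using hne) (measurableSet_singleton _)]
      refine measure_mono ?_
      rintro z (rfl | rfl)
      exacts [hx'.1, hy'.1]
    have h2 := ENNReal.add_lt_add hx'.2 hy'.2
    rw [← mul_add, ← two_mul] at h2
    exact absurd h2 (not_lt.2 (mul_le_mul_right h1 2))
  have hmain : ∀ᵐ p ∂m.fst, ¬ {t | (p, t) ∈ g '' Z'}.Countable := by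
    filter_upwards [hWae, ae_all_iff.2 hSnull] with p hp hpS hcount
    have hat : ∃ t, κ p {t} ≠ 0 := by
      by_contra! hno
      have h1 : κ p {t | (p, t) ∈ g '' Z'} = 0 := by
        rw [← Set.biUnion_of_singleton {t | (p, t) ∈ g '' Z'},
          measure_biUnion_null_iff hcount]
        exact fun t _ => hno t
      have h2 : κ p Set.univ = 0 := by
        refine le_antisymm ?_ zero_le
        calc κ p Set.univ ≤ κ p {t | (p, t) ∈ g '' Z'} + κ p {t | (p, t) ∈ g '' Z'}ᶜ := by
              rw [← Set.union_compl_self {t | (p, t) ∈ g '' Z'}]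
              exact measure_union_le _ _
          _ = 0 := by rw [h1, zero_add]; exact hp
      simp at h2
    obtain ⟨t, ht⟩ := hat
    have hlt : κ p {t} < 2 * κ p {t} := by
      rw [two_mul]
      exact ENNReal.lt_add_right (measure_ne_top _ _) ht
    -- Outer regularity puts every atom in some `S (a, b)`: small enough neighbourhoods of `t` have
    -- mass below `2 * κ p {t}`.
    obtain ⟨U, htU, hUo, hU⟩ := Set.exists_isOpen_lt_of_lt {t} _ hlt
    obtain ⟨I, hI, htI, hIU⟩ := Real.isTopologicalBasis_Ioo_rat.exists_subset_of_mem_open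
      (htU rfl) hUo
    simp only [Set.mem_iUnion, Set.mem_singleton_iff] at hI
    obtain ⟨a, b, -, rfl⟩ := hI
    have h1 := hpS (a, b)
    rw [ae_iff] at h1
    refine ht (measure_mono_null ?_ h1)
    rintro _ rfl
    simp only [not_not, Set.mem_ofPred_eq]
    exact ⟨htI, (measure_mono hIU).trans_lt hU⟩
  rw [hm, Measure.fst_map_prodMk hh] at hmain
  filter_upwards [ae_of_ae_map hq.aemeasurable hmain] with x hx hcount
  refine hx ((hcount.image h).mono ?_)
  rintro t ⟨y, hy, hyt⟩
  obtain ⟨h1, rfl⟩ := Prod.mk.inj hyt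
  exact ⟨y, ⟨hZ'Z hy, h1⟩, rfl⟩

section
variable (b : Module.Basis (Fin 3) ℝ (Fin 3 → ℝ))

/-- Either a full-measure set meets almost every leaf in an uncountable set, or some compact set of
positive measure meets every short leaf segment in at most one point. -/
theorem exists_compact_transversal {μ : Measure Torus3} [IsProbabilityMeasure μ]
    {Z : Set Torus3} (hZ : ∀ᵐ x ∂μ, x ∈ Z) {F : Torus3 → Set Torus3}
    (hF : ∀ x v, b.coord 0 v = 0 → b.coord 2 v = 0 → x + proj v ∈ F x)
    (hcon : ¬ ∀ᵐ x ∂μ, ¬ (Z ∩ F x).Countable) :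
    ∃ K : Set Torus3, IsCompact K ∧ μ K ≠ 0 ∧ ∀ x v, x ∈ K → x + proj v ∈ K →
      b.coord 0 v = 0 → b.coord 2 v = 0 → ‖v‖ < 1 / 2 → v = 0 := by
  have hcm : ∀ i, Measurable fun x => b.coord i (lift x) := fun i =>
    (continuous_coord b i).measurable.comp measurable_lift
  obtain ⟨S, hSm, hSi, hS⟩ : ∃ S, MeasurableSet S ∧
      Set.InjOn (fun x => (b.coord 0 (lift x), b.coord 2 (lift x))) S ∧ μ S ≠ 0 := by
    by_contra! hno
    refine hcon ?_
    have hinj : ∀ x y, (b.coord 0 (lift x), b.coord 2 (lift x)) =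
        (b.coord 0 (lift y), b.coord 2 (lift y)) → b.coord 1 (lift x) = b.coord 1 (lift y) →
        x = y := by
      intro x y h1 h2
      rw [← proj_lift x, ← proj_lift y]
      congr 1
      refine b.ext_elem fun i => ?_
      simp only [Prod.mk.injEq, Module.Basis.coord_apply] at h1 h2
      fin_cases i
      exacts [h1.1, h2, h1.2]
    filter_upwards [ae_not_countable_inter_fiber ((hcm 0).prodMk (hcm 2)) (hcm 1) hinj hno hZ]
      with x hx hcount
    refine hx (hcount.mono ?_)
    rintro y ⟨hyZ, hyx⟩
    refine ⟨hyZ, ?_⟩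
    simp only [Set.mem_preimage, Set.mem_singleton_iff, Prod.mk.injEq] at hyx
    rw [eq_add_proj_lift_sub x y]
    exact hF _ _ (by rw [map_sub, hyx.1, sub_self]) (by rw [map_sub, hyx.2, sub_self])
  -- Restricting to a cube of side `1/2` makes translation by a short `v` agree with translation of
  -- lifts, with no wrap-around.
  have hcube : ∃ c : Fin 3 → ℤ, μ (S ∩ {x | ∀ i, ⌊2 * lift x i⌋ = c i}) ≠ 0 := by
    by_contra! hno
    refine hS (measure_mono_null ?_ (measure_iUnion_null hno))
    intro x hx
    exact Set.mem_iUnion.2 ⟨fun i => ⌊2 * lift x i⌋, hx, fun i => rfl⟩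
  obtain ⟨c, hc⟩ := hcube
  have hm : MeasurableSet (S ∩ {x | ∀ i, ⌊2 * lift x i⌋ = c i}) := by
    refine hSm.inter ?_
    rw [Set.ofPred_forall]
    refine MeasurableSet.iInter fun i => ?_
    have : Measurable fun x => ⌊2 * lift x i⌋ :=
      Int.measurable_floor.comp (((measurable_pi_apply i).comp measurable_lift).const_mul 2)
    exact this (measurableSet_singleton (c i))
  obtain ⟨K, hKS, hK, hKμ⟩ := hm.exists_lt_isCompact_of_ne_top (measure_ne_top μ _)
    (pos_iff_ne_zero.2 hc)
  refine ⟨K, hK, hKμ.ne', fun x v hx hy h0 h2 hv => ?_⟩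
  have hx' := hKS hx
  have hy' := hKS hy
  have hlift : lift (x + proj v) = lift x + v := by
    have h1 : proj (lift (x + proj v) - lift x) = proj v := by
      rw [proj_sub, proj_lift, proj_lift]; abel
    have h2 : lift (x + proj v) - lift x = v := by
      refine eq_of_proj_eq h1 fun i => ?_
      have e1 : ⌊2 * lift x i⌋ = c i := hx'.2 i
      have e2 : ⌊2 * lift (x + proj v) i⌋ = c i := hy'.2 i
      rw [Int.floor_eq_iff] at e1 e2
      have h3 := (norm_le_pi_norm v i).trans_lt hv
      rw [Real.norm_eq_abs, abs_lt] at h3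
      rw [Pi.sub_apply, abs_lt]
      constructor <;> linarith [e1.1, e1.2, e2.1, e2.2, h3.1, h3.2]
    rw [← sub_eq_iff_eq_add']; exact h2
  have heq : x + proj v = x := hSi hy'.1 hx'.1 (by
    simp only [hlift, map_add, h0, h2, add_zero])
  rw [heq] at hlift
  simpa using hlift

/-- Quantitative form of transversality, by compactness. -/
theorem exists_transversal_modulus {K : Set Torus3} (hK : IsCompact K) {r : ℝ}
    (hr : 0 < r)
    (hKt : ∀ x v, x ∈ K → x + proj v ∈ K → b.coord 0 v = 0 → b.coord 2 v = 0 →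
      |b.coord 1 v| ≤ r → v = 0) {ε : ℝ} (hε : 0 < ε) :
    ∃ δ > 0, δ ≤ r ∧ ∀ x v, x ∈ K → x + proj v ∈ K → |b.coord 0 v| ≤ δ → |b.coord 2 v| ≤ δ →
      |b.coord 1 v| ≤ r → |b.coord 1 v| ≤ ε := by
  -- The compact set of pairs with center displacement at least `ε`. On it the transverse
  -- displacement never vanishes, hence is bounded below by some `a > 0`.
  let Q : Set (Torus3 × (Fin 3 → ℝ)) := {p | p.1 ∈ K ∧ p.1 + proj p.2 ∈ K ∧
    (∀ i, |b.coord i p.2| ≤ r) ∧ ε ≤ |b.coord 1 p.2|}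
  have hc : ∀ i, Continuous fun p : Torus3 × (Fin 3 → ℝ) => |b.coord i p.2| := fun i =>
    ((continuous_coord b i).comp continuous_snd).abs
  have hQ : IsCompact Q := by
    refine IsCompact.of_isClosed_subset
      (hK.prod (isCompact_closedBall (0 : Fin 3 → ℝ) ((∑ i, ‖b i‖) * r))) ?_ ?_
    · refine (hK.isClosed.preimage continuous_fst).inter ((hK.isClosed.preimage
        (continuous_fst.add (continuous_proj.comp continuous_snd))).inter (IsClosed.inter ?_ ?_))
      · change IsClosed {p : Torus3 × (Fin 3 → ℝ) | ∀ i, |b.coord i p.2| ≤ r}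
        rw [Set.ofPred_forall]
        exact isClosed_iInter fun i => isClosed_le (hc i) continuous_const
      · exact isClosed_le continuous_const (hc 1)
    · rintro ⟨x, v⟩ ⟨h1, -, h3, -⟩
      exact ⟨h1, by simpa using norm_le_of_coord_le b h3⟩
  obtain ⟨a, ha, haQ⟩ := hQ.exists_forall_le' (f := fun p => max |b.coord 0 p.2| |b.coord 2 p.2|)
    ((hc 0).max (hc 2)).continuousOn (a := 0) (by
      rintro ⟨x, v⟩ ⟨h1, h2, h3, h4⟩
      by_contra hle
      simp only [not_lt, max_le_iff, abs_nonpos_iff] at hle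
      have := hKt x v h1 h2 hle.1 hle.2 (h3 1)
      simp only [this, map_zero, abs_zero] at h4
      linarith)
  refine ⟨min r (a / 2), by positivity, min_le_left _ _, fun x v hx hy h0 h2 h1 => ?_⟩
  by_contra! hlt
  have := haQ (x, v) ⟨hx, hy, ?_, hlt.le⟩
  · have h3 := max_le h0 h2
    have h4 := min_le_right r (a / 2)
    simp only at this
    linarith
  · intro i
    fin_cases i
    exacts [h0.trans (min_le_left _ _), h1, h2.trans (min_le_left _ _)]

end

/-! ### Coding orbits -/

/-- In an ergodic system, the probability of missing a set of positive measure for a long time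
tends to zero. -/
theorem tendsto_measureReal_forall_notMem {X : Type*} [MeasurableSpace X] {μ : Measure X}
    [IsProbabilityMeasure μ] {f : X → X} (hf : Ergodic f μ) {K : Set X} (hK : MeasurableSet K)
    (hK0 : μ K ≠ 0) :
    Tendsto (fun M : ℕ => μ.real {x | ∀ j < M, f^[j] x ∉ K}) atTop (nhds 0) := by
  have hm : ∀ M : ℕ, MeasurableSet {x | ∀ j < M, f^[j] x ∉ K} := by
    intro M
    have : {x | ∀ j < M, f^[j] x ∉ K} = ⋂ j, ⋂ (_ : j < M), (f^[j] ⁻¹' K)ᶜ := by ext x; simp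
    rw [this]
    exact MeasurableSet.iInter fun j => MeasurableSet.iInter fun _ =>
      (hf.measurable.iterate j hK).compl
  have hnull : μ (⋂ M : ℕ, {x | ∀ j < M, f^[j] x ∉ K}) = 0 := by
    have hU : MeasurableSet (⋃ j : ℕ, f^[j] ⁻¹' K) :=
      MeasurableSet.iUnion fun j => hf.measurable.iterate j hK
    have hsub : f ⁻¹' (⋃ j : ℕ, f^[j] ⁻¹' K) ⊆ ⋃ j : ℕ, f^[j] ⁻¹' K := by
      intro x hx
      simp only [Set.mem_preimage, Set.mem_iUnion] at hx ⊢
      obtain ⟨j, hj⟩ := hx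
      exact ⟨j + 1, by rwa [Function.iterate_succ_apply]⟩
    have hcompl : (⋂ M : ℕ, {x | ∀ j < M, f^[j] x ∉ K}) = (⋃ j : ℕ, f^[j] ⁻¹' K)ᶜ := by
      ext x
      simp only [Set.mem_iInter, Set.mem_ofPred_eq, Set.mem_compl_iff, Set.mem_iUnion,
        Set.mem_preimage, not_exists]
      exact ⟨fun h j => h (j + 1) j (Nat.lt_succ_self j), fun h M j _ => h j⟩
    rw [hcompl]
    rcases hf.ae_empty_or_univ_of_preimage_ae_le hU.nullMeasurableSet
      (Eventually.of_forall hsub) with h | h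
    · exact absurd (measure_mono_null (Set.subset_iUnion (fun j : ℕ => f^[j] ⁻¹' K) 0)
        (ae_eq_empty.1 h)) hK0
    · exact ae_eq_univ.1 h
  have h := tendsto_measure_iInter_atTop (μ := μ) (fun M => (hm M).nullMeasurableSet)
    (fun M M' hMM' x hx j hj => hx j (hj.trans_le hMM')) ⟨0, measure_ne_top _ _⟩
  rw [hnull] at h
  exact (ENNReal.tendsto_toReal ENNReal.zero_ne_top).comp h

/-- A finite measurable partition is determined, at small scales, by a partition of small
entropy. -/
theorem exists_small_correction {X : Type*} [MetricSpace X] [CompactSpace X]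
    [MeasurableSpace X] [BorelSpace X] {μ : Measure X} [IsProbabilityMeasure μ] {k : ℕ}
    {ξ : X → Fin k} (hξ : Measurable ξ) {η : ℝ} (hη : 0 < η) :
    ∃ r > 0, ∃ ω : X → Fin 1 ⊕ Fin k, Measurable ω ∧ labelEntropy μ ω ≤ η ∧
      ∀ x y, dist x y < r → ω x = ω y → ξ x = ξ y := by
  classical
  obtain ⟨x₀⟩ : Nonempty X := μ.nonempty_of_neZero
  have : Nonempty (Fin k) := ⟨ξ x₀⟩
  have hk : (0 : ℝ) < k := by exact_mod_cast Fin.pos (ξ x₀)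
  obtain ⟨ρ, hρ, hρη⟩ : ∃ ρ > 0, ∀ t : ℝ, |t| < ρ →
      Real.binEntropy t + t * Real.log k < η := by
    have hcont : Continuous fun t : ℝ => Real.binEntropy t + t * Real.log k :=
      Real.binEntropy_continuous.add (continuous_id.mul continuous_const)
    have h0 : ∀ᶠ t in nhds (0 : ℝ), Real.binEntropy t + t * Real.log k < η :=
      hcont.continuousAt.eventually_lt continuousAt_const (by simpa using hη)
    obtain ⟨ρ, hρ, h⟩ := Metric.eventually_nhds_iff.1 h0
    exact ⟨ρ, hρ, fun t ht => h (by simpa using ht)⟩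
  -- Inner regularity: compact cores of the atoms, missing total mass less than `ρ`. They are
  -- pairwise at positive distance, so nearby points of the cores share their `ξ`-label, and `ω`
  -- needs to report `ξ` only off the cores.
  have hL : ∀ i, ∃ L ⊆ ξ ⁻¹' {i}, IsCompact L ∧ μ (ξ ⁻¹' {i} \ L) < ENNReal.ofReal (ρ / (2 * k)) :=
    fun i => (hξ (measurableSet_singleton i)).exists_isCompact_sdiff_lt (measure_ne_top _ _)
      (by simpa using by positivity)
  choose L hLsub hLc hLμ using hL
  have hsep : ∀ᶠ r in nhdsWithin (0 : ℝ) (Set.Ioi 0), ∀ i j, i ≠ j → ∀ x ∈ L i, ∀ y ∈ L j,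
      r ≤ dist x y := by
    rw [eventually_all]; intro i
    rw [eventually_all]; intro j
    by_cases hij : i = j
    · exact Eventually.of_forall fun r h => absurd hij h
    have hd : Disjoint (L i) (L j) := by
      refine Set.disjoint_left.2 fun x hx hy => hij ?_
      exact (hLsub i hx).symm.trans (hLsub j hy)
    obtain ⟨r, hr, h⟩ := Metric.exists_pos_forall_lt_edist (hLc i) (hLc j).isClosed hd
    have hr' : (0 : ℝ) < r := by exact_mod_cast hr
    filter_upwards [Ioo_mem_nhdsGT hr'] with s hs _ x hx y hy
    have := h x hx y hy
    rw [edist_nndist] at this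
    have h2 : r < nndist x y := by exact_mod_cast this
    have h3 : (r : ℝ) < dist x y := by exact_mod_cast h2
    exact (hs.2.trans h3).le
  obtain ⟨r, hr, hr0⟩ := (hsep.and self_mem_nhdsWithin).exists
  set U := ⋃ i, L i with hU
  have hUm : MeasurableSet U := MeasurableSet.iUnion fun i => (hLc i).measurableSet
  let ω : X → Fin 1 ⊕ Fin k := fun x => if x ∈ U then Sum.inl 0 else Sum.inr (ξ x)
  have hω : Measurable ω :=
    Measurable.ite hUm measurable_const (measurable_inr.comp hξ)
  have hωU : ω ⁻¹' Set.range Sum.inr = Uᶜ := by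
    ext x
    by_cases hx : x ∈ U <;> simp [ω, hx]
  refine ⟨r, hr0, ω, hω, ?_, fun x y hxy hω => ?_⟩
  · refine (labelEntropy_sum_le hω).trans ?_
    rw [hωU]
    simp only [Fintype.card_fin, Nat.cast_one, Real.log_one, add_zero]
    refine (hρη _ ?_).le
    rw [abs_of_nonneg measureReal_nonneg]
    have hcover : Uᶜ ⊆ ⋃ i, ξ ⁻¹' {i} \ L i := by
      intro x hx
      refine Set.mem_iUnion.2 ⟨ξ x, rfl, fun h => hx (Set.mem_iUnion.2 ⟨_, h⟩)⟩
    calc μ.real Uᶜ ≤ μ.real (⋃ i, ξ ⁻¹' {i} \ L i) := measureReal_mono hcover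
      _ ≤ ∑ i, μ.real (ξ ⁻¹' {i} \ L i) := measureReal_iUnion_fintype_le _
      _ ≤ ∑ _i : Fin k, ρ / (2 * k) := Finset.sum_le_sum fun i _ =>
          ENNReal.toReal_le_of_le_ofReal (by positivity) (hLμ i).le
      _ = ρ / 2 := by
          rw [Finset.sum_const, Finset.card_univ, Fintype.card_fin, nsmul_eq_mul]; field_simp
      _ < ρ := by linarith
  · simp only [ω] at hω
    split_ifs at hω with hx hy hy
    · obtain ⟨i, hi⟩ := Set.mem_iUnion.1 hx
      obtain ⟨j, hj⟩ := Set.mem_iUnion.1 hy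
      by_cases hij : i = j
      · exact (hLsub i hi).trans (hij.trans (hLsub j hj).symm)
      · exact absurd hxy (not_lt.2 (hr i j hij x hi y hj))
    · exact Sum.inr_injective hω

/-- The label recording the first visit to `K` before time `M` or, if there is none, the value
of `τ`. -/
theorem exists_visit_label {X : Type*} [MeasurableSpace X] {f : X → X} (hf : Measurable f)
    {K : Set X} (hK : MeasurableSet K) (M : ℕ) {m : ℕ} {τ : X → Fin m} (hτ : Measurable τ) :
    ∃ φ : X → Fin M ⊕ Fin m, Measurable φ ∧ (∀ x j, φ x = Sum.inl j → f^[j] x ∈ K) ∧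
      (∀ x k, φ x = Sum.inr k → τ x = k) ∧
      φ ⁻¹' Set.range Sum.inr = {x | ∀ j < M, f^[j] x ∉ K} := by
  classical
  let φ : X → Fin M ⊕ Fin m := fun x =>
    if h : ∃ j, j < M ∧ f^[j] x ∈ K then Sum.inl ⟨Nat.find h, (Nat.find_spec h).1⟩
    else Sum.inr (τ x)
  have hl : ∀ x j, φ x = Sum.inl j ↔ f^[j] x ∈ K ∧ ∀ i < (j : ℕ), f^[i] x ∉ K := by
    intro x j
    by_cases h : ∃ j, j < M ∧ f^[j] x ∈ K
    · simp only [φ, dif_pos h, Sum.inl.injEq, Fin.ext_iff, Nat.find_eq_iff]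
      constructor
      · rintro ⟨⟨-, h1⟩, h2⟩
        exact ⟨h1, fun i hi hiK => h2 i hi ⟨hi.trans j.2, hiK⟩⟩
      · rintro ⟨h1, h2⟩
        exact ⟨⟨j.2, h1⟩, fun i hi hiK => h2 i hi hiK.2⟩
    · simp only [φ, dif_neg h, reduceCtorEq, false_iff, not_and]
      exact fun hj => absurd ⟨j, j.2, hj⟩ h
  have hr : ∀ x k, φ x = Sum.inr k ↔ (∀ j < M, f^[j] x ∉ K) ∧ τ x = k := by
    intro x k
    by_cases h : ∃ j, j < M ∧ f^[j] x ∈ K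
    · simp only [φ, dif_pos h, reduceCtorEq, false_iff, not_and]
      obtain ⟨j, hj, hjK⟩ := h
      exact fun h => absurd hjK (h j hj)
    · simp only [φ, dif_neg h, Sum.inr.injEq]
      push Not at h
      simp only [iff_and_self]
      exact fun _ => h
  have hmj : ∀ j : ℕ, MeasurableSet {x | f^[j] x ∉ K} := fun j => (hf.iterate j hK).compl
  refine ⟨φ, measurable_to_countable' ?_, fun x j h => ((hl x j).1 h).1,
    fun x k h => ((hr x k).1 h).2, ?_⟩
  · rintro (j | k)
    · have : φ ⁻¹' {Sum.inl j} = f^[j] ⁻¹' K ∩ ⋂ i, ⋂ (_ : i < (j : ℕ)), {x | f^[i] x ∉ K} := by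
        ext x; simp [hl]
      rw [this]
      exact (hf.iterate j hK).inter
        (MeasurableSet.iInter fun i => MeasurableSet.iInter fun _ => hmj i)
    · have : φ ⁻¹' {Sum.inr k} = (⋂ i, ⋂ (_ : i < M), {x | f^[i] x ∉ K}) ∩ τ ⁻¹' {k} := by
        ext x; simp [hr]
      rw [this]
      exact (MeasurableSet.iInter fun i => MeasurableSet.iInter fun _ => hmj i).inter
        (hτ (measurableSet_singleton k))
  · ext x
    simp only [Set.mem_preimage, Set.mem_range, Set.mem_ofPred_eq]
    constructor
    · rintro ⟨k, hk⟩; exact ((hr x k).1 hk.symm).1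
    · exact fun h => ⟨τ x, ((hr x _).2 ⟨h, rfl⟩).symm⟩

/-- Two nearby points with the same visit labels stay close in the middle direction. -/
theorem coord_bound_of_visit_labels {A : Matrix (Fin 3) (Fin 3) ℤ} {lam : Fin 3 → ℝ}
    {b : Module.Basis (Fin 3) ℝ (Fin 3 → ℝ)} (hb : ∀ i, realMap A (b i) = lam i • b i)
    (h0 : |lam 0| ≤ 1) (h1 : 1 ≤ lam 1) (h2 : 1 ≤ lam 2) {K : Set Torus3} {M m N : ℕ}
    {ε δ r : ℝ} (hεr : ε * lam 1 ^ (2 * M) ≤ r) (hδr : δ ≤ r)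
    (hr : (∑ i, ‖b i‖) * (2 * r) < 1)
    (hK : ∀ x v, x ∈ K → x + proj v ∈ K → |b.coord 0 v| ≤ δ → |b.coord 2 v| ≤ δ →
      |b.coord 1 v| ≤ r → |b.coord 1 v| ≤ ε)
    {τ : Torus3 → Fin m}
    (hτ : ∀ x y, τ x = τ y → ∃ v, y = x + proj v ∧ ∀ i, |b.coord i v| ≤ ε)
    {φ : Torus3 → Fin M ⊕ Fin m} (hφl : ∀ x j, φ x = Sum.inl j → (torusMap A)^[j] x ∈ K)
    (hφr : ∀ x k, φ x = Sum.inr k → τ x = k) {x : Torus3} {v : Fin 3 → ℝ}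
    (hv0 : |b.coord 0 v| ≤ δ) (hv1 : |b.coord 1 v| ≤ ε)
    (hv2 : |b.coord 2 v| * lam 2 ^ (M * N) ≤ δ)
    (hφ : ∀ k < N, φ ((torusMap A)^[M * k] x) = φ ((torusMap A)^[M * k] (x + proj v)))
    {j : ℕ} (hj : j < M * N) (i : Fin 3) : |b.coord i ((realMap A ^ j) v)| ≤ r := by
  set f := torusMap A
  have hε0 : 0 ≤ ε := (abs_nonneg _).trans hv1
  have hc0 : ∀ j, |b.coord 0 ((realMap A ^ j) v)| ≤ δ := by
    intro j
    rw [coord_realMap_pow hb, abs_mul, abs_pow]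
    exact (mul_le_of_le_one_left (abs_nonneg _) (pow_le_one₀ (abs_nonneg _) h0)).trans hv0
  have hc2 : ∀ j ≤ M * N, |b.coord 2 ((realMap A ^ j) v)| ≤ δ := by
    intro j hj
    rw [coord_realMap_pow hb, abs_mul, abs_pow, abs_of_nonneg (zero_le_one.trans h2), mul_comm]
    exact (mul_le_mul_of_nonneg_left (pow_le_pow_right₀ h2 hj) (abs_nonneg _)).trans hv2
  have hc1 : ∀ j, |b.coord 1 ((realMap A ^ j) v)| = |b.coord 1 v| * lam 1 ^ j := by
    intro j
    rw [coord_realMap_pow hb, abs_mul, abs_pow, abs_of_nonneg (zero_le_one.trans h1), mul_comm]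
  have hgrow : ∀ c j, |b.coord 1 v| * lam 1 ^ c ≤ ε → j ≤ c + 2 * M →
      |b.coord 1 ((realMap A ^ j) v)| ≤ r := by
    intro c j hc hj
    rw [hc1]
    calc |b.coord 1 v| * lam 1 ^ j ≤ |b.coord 1 v| * lam 1 ^ (c + 2 * M) := by gcongr
      _ = |b.coord 1 v| * lam 1 ^ c * lam 1 ^ (2 * M) := by rw [pow_add]; ring
      _ ≤ ε * lam 1 ^ (2 * M) := by gcongr
      _ ≤ r := hεr
  have hεr' : ε ≤ r := (le_mul_of_one_le_right hε0 (one_le_pow₀ h1)).trans hεr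
  -- Invariant: some checkpoint `c` in `[M * k - M, M * k]` has center displacement at most `ε`. The
  -- next one is a common visit to `K`, or time `M * k` itself when there is no visit; both lie
  -- fewer than `2 * M` steps after `c`.
  have hcheck : ∀ k ≤ N, ∃ c, M * k ≤ c + M ∧ c ≤ M * k ∧ |b.coord 1 v| * lam 1 ^ c ≤ ε := by
    intro k
    induction k with
    | zero => intro _; exact ⟨0, by simp, by simp, by simpa using hv1⟩
    | succ k ih =>
      intro hk
      obtain ⟨c, hc1', hc2', hc⟩ := ih (by omega)
      have hkN : M * k + M ≤ M * N := by
        have := Nat.mul_le_mul_left M hk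
        rwa [Nat.mul_succ] at this
      have heq := hφ k (by omega)
      rcases hcase : φ (f^[M * k] x) with j | t
      · have hx := hφl _ _ hcase
        have hy := hφl _ _ (heq ▸ hcase)
        rw [← Function.iterate_add_apply] at hx hy
        rw [torusMap_iterate_add_proj] at hy
        have hj := j.2
        have := hK _ _ hx hy (hc0 _) (hc2 _ (by omega)) (hgrow c _ hc (by omega))
        rw [hc1] at this
        exact ⟨j + M * k, by rw [Nat.mul_succ]; omega, by rw [Nat.mul_succ]; omega, this⟩
      · have hx := hφr _ _ hcase
        have hy := hφr _ _ (heq ▸ hcase)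
        obtain ⟨w, hw, hwε⟩ := hτ _ _ (hx.trans hy.symm)
        rw [torusMap_iterate_add_proj] at hw
        -- `τ` bounds only some displacement `w` between the two points. Both vectors are short, so
        -- `w` is the true displacement.
        have hvw : (realMap A ^ (M * k)) v = w := by
          refine eq_of_proj_eq_of_coord_le b hr ?_ (fun i => (hwε i).trans hεr')
            (add_left_cancel hw)
          intro i
          fin_cases i
          exacts [(hc0 _).trans hδr, hgrow c _ hc (by omega),
            (hc2 _ (by omega)).trans hδr]
        have := hwε 1
        rw [← hvw, hc1] at this
        exact ⟨M * k, by rw [Nat.mul_succ], by rw [Nat.mul_succ]; omega, this⟩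
  have hM : 0 < M := Nat.pos_of_ne_zero fun h => by simp [h] at hj
  fin_cases i
  · exact (hc0 j).trans hδr
  · obtain ⟨c, hc1', -, hc⟩ := hcheck (j / M) (Nat.div_le_of_le_mul hj.le)
    have h3 := Nat.div_add_mod j M
    have h4 := Nat.mod_lt j hM
    exact hgrow c j hc (by omega)
  · exact (hc2 j hj.le).trans hδr

/-! ### The entropy bound -/

theorem log_div_div_pow_add_one_le {B a l : ℝ} (hB : 0 < B) (ha : 0 < a) (hl : 1 ≤ l) (n : ℕ) :
    Real.log (B / (a / l ^ n) + 1) ≤ Real.log (B / a + 1) + n * Real.log l := by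
  have hl0 : 0 < l := by linarith
  have hn : 1 ≤ l ^ n := one_le_pow₀ hl
  rw [← Real.log_pow, ← Real.log_mul (by positivity) (by positivity)]
  refine Real.log_le_log (by positivity) ?_
  have : B / (a / l ^ n) = B / a * l ^ n := by field_simp
  rw [this]
  nlinarith

/-- If a compact set of positive measure meets short segments in the middle direction at most once,
then block entropies grow at most at the rate given by the largest eigenvalue. -/
theorem exists_blockEntropy_le {A : Matrix (Fin 3) (Fin 3) ℤ} {lam : Fin 3 → ℝ}
    {b : Module.Basis (Fin 3) ℝ (Fin 3 → ℝ)} (hb : ∀ i, realMap A (b i) = lam i • b i)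
    (h0 : |lam 0| ≤ 1) (h1 : 1 ≤ lam 1) (h2 : 1 ≤ lam 2)
    {μ : Measure Torus3} [IsProbabilityMeasure μ] (hμ : Ergodic (torusMap A) μ)
    {K : Set Torus3} (hK : IsCompact K) (hKμ : μ K ≠ 0)
    (hKt : ∀ x v, x ∈ K → x + proj v ∈ K → b.coord 0 v = 0 → b.coord 2 v = 0 → ‖v‖ < 1 / 2 →
      v = 0) {k : ℕ} {ξ : Torus3 → Fin k} (hξ : Measurable ξ) {η : ℝ} (hη : 0 < η) :
    ∃ C : ℝ, ∀ n : ℕ, blockEntropy μ (torusMap A) ξ n ≤ n * (Real.log (lam 2) + 3 * η) + C := by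
  obtain ⟨r₀, hr₀, ω, hωm, hωη, hω⟩ := exists_small_correction (μ := μ) hξ hη
  set D := ∑ i, ‖b i‖ with hD
  have hD0 : 0 ≤ D := Finset.sum_nonneg fun _ _ => norm_nonneg _
  -- Displacements with coordinates at most `r` must be shorter than `r₀`, so that `ω` determines
  -- `ξ`, and shorter than the `1/2` in the transversality of `K`.
  obtain ⟨r, hr, hrD₀, hrD⟩ : ∃ r > 0, D * r < r₀ ∧ D * (2 * r) < 1 / 2 := by
    have hc : Tendsto (fun r : ℝ => D * r) (nhdsWithin 0 (Set.Ioi 0)) (nhds 0) := by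
      have : Tendsto (fun r : ℝ => D * r) (nhds 0) (nhds (D * 0)) :=
        (continuous_const.mul continuous_id).tendsto 0
      rw [mul_zero] at this
      exact this.mono_left nhdsWithin_le_nhds
    obtain ⟨r, hr1, hr2, hr3⟩ := ((hc.eventually_lt_const hr₀).and
      ((hc.eventually_lt_const (by norm_num : (0 : ℝ) < 1 / 4)).and self_mem_nhdsWithin)).exists
    exact ⟨r, hr3, hr1, by linarith⟩
  obtain ⟨B, hB, hbox⟩ := exists_box_label b
  set C₁ := Real.log (B / r + 1) with hC₁
  have hC₁0 : 0 ≤ C₁ := Real.log_nonneg (by have := div_pos hB hr; linarith)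
  -- The factor `6` is three coordinates times the exponent `2 * M` in `ε`, per unit of `M`. The two
  -- bounds together give `2 * η * M` for the entropy of `φ`.
  obtain ⟨M, hM0, hMlog, hMρ⟩ : ∃ M : ℕ, 0 < M ∧
      Real.log 2 + Real.log M + 3 * C₁ ≤ η * M ∧
      μ.real {x | ∀ j < M, (torusMap A)^[j] x ∉ K} * (6 * Real.log (lam 1)) ≤ η := by
    have e1 : ∀ᶠ M : ℕ in atTop, Real.log 2 + Real.log M + 3 * C₁ ≤ η * M := by
      have hlog : ∀ᶠ M : ℕ in atTop, Real.log M ≤ η / 2 * M := by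
        have h := (Real.isLittleO_log_id_atTop.comp_tendsto
          tendsto_natCast_atTop_atTop).def (c := η / 2) (by positivity)
        filter_upwards [h] with M hM
        simp only [Function.comp_apply, id, Real.norm_eq_abs, Nat.abs_cast] at hM
        exact (le_abs_self _).trans hM
      have hlin : ∀ᶠ M : ℕ in atTop, Real.log 2 + 3 * C₁ ≤ η / 2 * M :=
        (tendsto_natCast_atTop_atTop.const_mul_atTop (by positivity)).eventually_ge_atTop _
      filter_upwards [hlog, hlin] with M h1 h2
      linarith
    have e2 := (tendsto_measureReal_forall_notMem hμ hK.measurableSet hKμ).mul_const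
      (6 * Real.log (lam 1))
    rw [zero_mul] at e2
    obtain ⟨M, h1, h2, h3⟩ := ((eventually_gt_atTop 0).and
      (e1.and (e2.eventually_le_const hη))).exists
    exact ⟨M, h1, h2, h3⟩
  set ρ := μ.real {x | ∀ j < M, (torusMap A)^[j] x ∉ K} with hρ
  have hl1 : 0 < lam 1 := by linarith
  have hl2 : 0 < lam 2 := by linarith
  set ε := r / lam 1 ^ (2 * M) with hε
  have hε0 : 0 < ε := by positivity
  have hεr : ε * lam 1 ^ (2 * M) ≤ r := by rw [hε, div_mul_cancel₀ _ (by positivity)]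
  obtain ⟨δ, hδ, hδr, hKδ⟩ := exists_transversal_modulus b hK hr (ε := ε) (fun x v hx hy h0 h2 h1 =>
    hKt x v hx hy h0 h2 (by
      have hle : ∀ i, |b.coord i v| ≤ r := by
        intro i
        fin_cases i
        exacts [by simpa [h0] using hr.le, h1, by simpa [h2] using hr.le]
      have := norm_le_of_coord_le b hle
      have := mul_nonneg hD0 hr.le
      linarith)) hε0
  obtain ⟨m, τ, hτm, hτcard, hτ⟩ := hbox (fun _ => ε) (fun _ => hε0)
  obtain ⟨φ, hφm, hφl, hφr, hφρ⟩ :=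
    exists_visit_label hμ.measurable hK.measurableSet M hτm
  have hφH : labelEntropy μ φ ≤ 2 * η * M := by
    have : Nonempty (Fin M) := ⟨⟨0, hM0⟩⟩
    have : Nonempty (Fin m) := ⟨τ 0⟩
    have h := labelEntropy_sum_le (μ := μ) hφm
    rw [hφρ, ← hρ, Fintype.card_fin, Fintype.card_fin] at h
    have hbin : Real.binEntropy ρ ≤ Real.log 2 := Real.binEntropy_le_log_two
    have hρ0 : 0 ≤ ρ := measureReal_nonneg
    have hρ1 : ρ ≤ 1 := measureReal_le_one
    have hεlog := log_div_div_pow_add_one_le hB hr h1 (2 * M)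
    rw [← hε, ← hC₁] at hεlog
    push_cast at hεlog
    rw [Finset.sum_const, Finset.card_univ, Fintype.card_fin, nsmul_eq_mul] at hτcard
    have hm : ρ * Real.log m ≤ ρ * (3 * (C₁ + 2 * M * Real.log (lam 1))) := by
      gcongr
      push_cast at hτcard
      linarith
    have h3 : ρ * (3 * C₁) ≤ 3 * C₁ := mul_le_of_le_one_left (by positivity) hρ1
    have h4 := mul_le_mul_of_nonneg_right hMρ (Nat.cast_nonneg (α := ℝ) M)
    linarith
  refine ⟨2 * Real.log (B / δ + 1) + Real.log (B / ε + 1) + M * Real.log (lam 2) + 2 * η * M,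
    fun n => ?_⟩
  -- Enough windows to cover `[0, n)`, overshooting by at most `M`, which only affects the constant.
  set N := n / M + 1 with hN
  have hNn : n ≤ M * N ∧ M * N ≤ n + M := by
    have h3 := Nat.div_add_mod n M
    have h4 := Nat.mod_lt n hM0
    rw [hN, Nat.mul_succ]
    omega
  obtain ⟨p, ζ, hζm, hζcard, hζ⟩ := hbox ![δ, ε, δ / lam 2 ^ (M * N)] (by
    intro i
    fin_cases i
    exacts [hδ, hε0, div_pos hδ (by positivity)])
  have hζlog : Real.log p ≤ 2 * Real.log (B / δ + 1) + Real.log (B / ε + 1) +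
      (M * N : ℕ) * Real.log (lam 2) := by
    have := log_div_div_pow_add_one_le hB hδ h2 (M * N)
    rw [Fin.sum_univ_three] at hζcard
    simp only [Matrix.cons_val_zero, Matrix.cons_val_one, Matrix.cons_val] at hζcard
    linarith
  have hinv := hμ.toMeasurePreserving
  -- Visit labels are sampled once per window, under the `M`-th iterate, so the cost `2 * η * M` of
  -- a label is `2 * η` per unit time.
  set Φ : Torus3 → Fin N → Fin M ⊕ Fin m := fun x i => φ (((torusMap A)^[M])^[i] x) with hΦ
  set W : Torus3 → Fin n → Fin 1 ⊕ Fin k := fun x i => ω ((torusMap A)^[i] x) with hW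
  have hΦm : Measurable Φ := measurable_pi_lambda _ fun i =>
    hφm.comp ((hinv.measurable.iterate M).iterate i)
  have hWm : Measurable W := measurable_pi_lambda _ fun i =>
    hωm.comp (hinv.measurable.iterate i)
  have hfac : blockEntropy μ (torusMap A) ξ n ≤ labelEntropy μ (fun x => (W x, (ζ x, Φ x))) := by
    rw [blockEntropy_eq_labelEntropy]
    refine labelEntropy_le_of_factors (hWm.prodMk (hζm.prodMk hΦm)) fun x y hxy => ?_
    simp only [Prod.mk.injEq] at hxy
    obtain ⟨hWxy, hζxy, hΦxy⟩ := hxy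
    obtain ⟨v, rfl, hv⟩ := hζ x y hζxy
    funext i
    refine hω _ _ ?_ (congrFun hWxy i)
    have hv2 := hv 2
    simp only [Matrix.cons_val] at hv2
    rw [le_div_iff₀ (by positivity)] at hv2
    have hcoord := coord_bound_of_visit_labels hb h0 h1 h2 hεr hδr (hrD.trans (by norm_num))
      hKδ hτ hφl hφr (hv 0) (hv 1) hv2 (N := N) (fun j hj => by
        have := congrFun hΦxy ⟨j, hj⟩
        simpa only [hΦ, ← Function.iterate_mul] using this) (j := i) (i.2.trans_le hNn.1)
    rw [torusMap_iterate_add_proj]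
    exact (dist_add_proj_le _ _).trans_lt ((norm_le_of_coord_le b hcoord).trans_lt hrD₀)
  have hH1 := labelEntropy_prod_le (μ := μ) hWm (hζm.prodMk hΦm)
  have hH2 := labelEntropy_prod_le (μ := μ) hζm hΦm
  have hH3 := labelEntropy_block_le hωm hinv n
  have hH4 := labelEntropy_block_le hφm (hinv.iterate M) N
  have hH5 := labelEntropy_le_log_card (μ := μ) hζm
  rw [Fintype.card_fin] at hH5
  have hMN : ((M * N : ℕ) : ℝ) ≤ n + M := by exact_mod_cast hNn.2
  have hlog2 : 0 ≤ Real.log (lam 2) := Real.log_nonneg h2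
  have g1 : (n : ℝ) * labelEntropy μ ω ≤ n * η := by gcongr
  have g2 : (N : ℝ) * labelEntropy μ φ ≤ 2 * η * (n + M) := by
    calc (N : ℝ) * labelEntropy μ φ ≤ N * (2 * η * M) := by gcongr
      _ = 2 * η * (M * N : ℕ) := by push_cast; ring
      _ ≤ _ := by gcongr
  have g3 : ((M * N : ℕ) : ℝ) * Real.log (lam 2) ≤ (n + M) * Real.log (lam 2) := by gcongr
  linarith

/-- The slack `c - a` absorbs `C / n` for large `n`. -/
theorem partitionEntropy_le_of_blockEntropy_le {X : Type*} [MeasurableSpace X] {μ : Measure X}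
    {f : X → X} {k : ℕ} {ξ : X → Fin k} {a c : ℝ} (hac : a < c) {C : ℝ}
    (h : ∀ n : ℕ, blockEntropy μ f ξ n ≤ n * a + C) : partitionEntropy μ f ξ ≤ (c : EReal) := by
  refine limsup_le_of_le (by isBoundedDefault) ?_
  have hlin : ∀ᶠ n : ℕ in atTop, C ≤ (c - a) * n :=
    (tendsto_natCast_atTop_atTop.const_mul_atTop (sub_pos.2 hac)).eventually_ge_atTop _
  filter_upwards [hlin, eventually_gt_atTop 0] with n hn hn0
  rw [EReal.coe_le_coe_iff, div_le_iff₀ (by exact_mod_cast hn0)]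
  linarith [h n]

end TorusEntropy

end

theorem theoremt (A : Matrix (Fin 3) (Fin 3) ℤ) (hA : IsUnit A.det)
    (lam₁ lam₂ lam₃ : ℝ)
    (h₁ : (TorusEntropy.realMap A).HasEigenvalue lam₁)
    (h₂ : (TorusEntropy.realMap A).HasEigenvalue lam₂)
    (h₃ : (TorusEntropy.realMap A).HasEigenvalue lam₃)
    (h₁_lt : lam₁ < 1) (h₂_gt : 1 < lam₂) (h₂₃ : lam₂ < lam₃)
    (μ : MeasureTheory.Measure TorusEntropy.Torus3) [MeasureTheory.IsProbabilityMeasure μ]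
    (hμ : Ergodic (TorusEntropy.torusMap A) μ)
    (hent : (Real.log lam₃ : EReal) < TorusEntropy.metricEntropy μ (TorusEntropy.torusMap A))
    (Z : Set TorusEntropy.Torus3) (hZ : ∀ᵐ x ∂μ, x ∈ Z) :
    ∀ᵐ x ∂μ, ¬ (Z ∩ TorusEntropy.eigenLeaf A lam₂ x).Countable := by
  open TorusEntropy in
  by_contra hcon
  have hinj : Function.Injective ![lam₁, lam₂, lam₃] := by
    intro i j hij
    fin_cases i <;> fin_cases j <;> simp at hij ⊢ <;> linarith
  obtain ⟨b, hb⟩ := exists_eigenbasis hinj (by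
    intro i
    fin_cases i
    exacts [h₁, h₂, h₃])
  have hprod := abs_prod_eigenvalues hA hb
  rw [Fin.prod_univ_three, abs_mul, abs_mul] at hprod
  -- `λ₁` could a priori be very negative; the product of absolute values being `1` excludes this,
  -- since `λ₂` and `λ₃` exceed `1`.
  have hl0 : |lam₁| ≤ 1 := by
    by_contra! hlt
    have e2 : 1 < |lam₂| := h₂_gt.trans_le (le_abs_self _)
    have e3 : 1 < |lam₃| := (h₂_gt.trans h₂₃).trans_le (le_abs_self _)
    have := one_lt_mul (one_lt_mul hlt.le e2).le e3
    simp only [Matrix.cons_val_zero, Matrix.cons_val_one, Matrix.cons_val] at hprod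
    linarith
  obtain ⟨K, hK, hKμ, hKt⟩ := exists_compact_transversal b hZ (F := eigenLeaf A lam₂) (by
    intro x v h0 h2
    refine ⟨v, ?_, rfl⟩
    rw [Module.End.mem_eigenspace_iff]
    have hv : v = b.coord 1 v • b 1 := by
      conv_lhs => rw [← b.sum_repr v]
      rw [Module.Basis.coord_apply] at h0 h2 ⊢
      rw [Fin.sum_univ_three, h0, h2]
      simp
    rw [hv, map_smul, hb, smul_comm]
    rfl) hcon
  simp only [metricEntropy, lt_iSup_iff] at hent
  obtain ⟨k, ξ, hξ, hlt⟩ := hent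
  obtain ⟨c, hc1, hc2⟩ := EReal.lt_iff_exists_real_btwn.1 hlt
  have hc1' : Real.log lam₃ < c := by exact_mod_cast hc1
  obtain ⟨C, hC⟩ := exists_blockEntropy_le hb hl0 h₂_gt.le (h₂_gt.trans h₂₃).le hμ hK hKμ hKt hξ
    -- A quarter of the gap, so that the loss `3 * η` stays strictly below it.
    (η := (c - Real.log lam₃) / 4) (by linarith)
  refine absurd hc2 (not_lt.2 (partitionEntropy_le_of_blockEntropy_le ?_ hC))
  change Real.log lam₃ + _ < c
  linarith
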